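/- Fix an alphabet $L$. A *conclist* is a finite set of events, totally ordered by a strict event order $\dashrightarrow$ and labelled in $L$. The category $\square$ has conclists as objects; a morphism $U\to V$ is a pair $(f,\varepsilon)$, where $f:U\to V$ preserves order and labels and $\varepsilon:V\to\{0,\mathrm{exec},1\}$ satisfies $\varepsilon^{-1}(\mathrm{exec})=f(U)$. Composition is $(g,\zeta)\circ(f,\varepsilon)=(g\circ f,\eta)$, with $\eta(g(v))=\varepsilon(v)$ and $\eta=\zeta$ outside the image of $g$. A *precubical set* is a presheaf $X:\square^{\mathrm{op}}\to\mathbf{Set}$. It is *finitely branching* if every cell is a face of only finitely many cells, where cells that differ by a renaming of events along an isomorphism of conclists are identified. For a conclist $S$, an *HDA in $\mathrm{HDA}_S$* is a precubical set $X$ with an initial cell $i_X\in X[S]$ and a set of final cells. An *interval ipomset* $P$ is a finite $L$-labelled set with two strict partial orders, the precedence order $<$ and the event order $\dashrightarrow$, such that any two distinct events are related by $<$ or $\dashrightarrow$; such that $x<z$ and $y<w$ imply $x<w$ or $y<z$; and with a source interface $S_P$ of $<$-minimal events and a target interface $T_P$ of $<$-maximal events. A morphism $P\to Q$ of interval ipomsets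 is a pair $(f,\varepsilon)$. Here $f$ is injective, preserves labels, reflects $<$, and preserves $\dashrightarrow$ between $<$-incomparable events. The map $\varepsilon:Q\to\{0,\mathrm{exec},1\}$ satisfies $\varepsilon^{-1}(\mathrm{exec})=f(P)$, and $q<q'$ implies $(\varepsilon(q),\varepsilon(q'))\notin\{(0,\mathrm{exec}),(0,1),(\mathrm{exec},1)\}$. Composition is as in $\square$. The *track object* $\square^P$ is the precubical set $U\mapsto\hom(U,P)$, and a *track* in $X$ is a precubical map $\square^P\to X$. If $T_P\simeq S_R$, the *gluing* $P*R$ is obtained from $P\sqcup R$ by identifying $T_P$ with $S_R$; its precedence order is $<_P\cup<_R\cup(P\setminus T_P)\times(R\setminus S_R)$, its event order is the transitive closure of $\dashrightarrow_P\cup\dashrightarrow_R$, and its interfaces are $S_P$ and $T_R$. The *initial inclusion* $\mathbf i_P^{P*R}:\square^P\to\square^{P*R}$ is induced by the inclusion $P\subseteq P*R$ with status $0$ outside $P$. Let $\mathbf T^0_S$ consist of the track objects $\square^P$ with $S_P\simeq S$ and the initial inclusions $\mathbf i_P^Q$ (for $Q\cong P*R$ for some $R$) between them. The *initial track* of an HDA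 in $\mathrm{HDA}_S$ is the unique precubical map $\iota_X:\square^S\to X$ that sends the top cell of $\square^S$ to $i_X$, where $S$ is regarded as the ipomset with empty precedence order and both interfaces equal to $S$. A *track-bisimulation* between $Y,Z\in\mathrm{HDA}_S$ is a relation $\mathsf R$ between tracks $p_1:\square^P\to Y$ and $p_2:\square^P\to Z$ with common domain $\square^P$ in $\mathbf T^0_S$, such that $\iota_Y$ and $\iota_Z$ are related and the following holds for all $(p_1,p_2)\in\mathsf R$ and all $\mathbf i_P^{Q}$ in $\mathbf T^0_S$. For every $p_1':\square^Q\to Y$ with $p_1'\circ\mathbf i_P^Q=p_1$ there is $p_2':\square^Q\to Z$ with $p_2'\circ\mathbf i_P^Q=p_2$ and $(p_1',p_2')\in\mathsf R$; and symmetrically with $Y$ and $Z$ exchanged. It is *strong* if, in addition, $(p_1,p_2)\in\mathsf R$ with domain $\square^Q$ implies $(p_1\circ\mathbf i_P^Q,p_2\circ\mathbf i_P^Q)\in\mathsf R$ for every $\mathbf i_P^Q$ in $\mathbf T^0_S$. Two HDAs are *(strong) track-bisimilar* if there is a (strong) track-bisimulation between them. The formulas of *Ipomset Modal Logic* (IPML)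 are $$F,G::=\top\mid\bot\mid\neg F\mid F\wedge G\mid F\vee G\mid\langle\mathbf i_P^{Q}\rangle F\mid\overline{\langle\mathbf i_P^{Q}\rangle}F,$$ with $\mathbf i_P^Q$ a morphism of $\mathbf T^0_S$. They are typed by the domain of the tracks at which they are evaluated: $\langle\mathbf i_P^Q\rangle F$ has type $P$ if $F$ has type $Q$, $\overline{\langle\mathbf i_P^Q\rangle}F$ has type $Q$ if $F$ has type $P$, and the Boolean connectives keep the type. Satisfaction by a track $p$ is as usual for the Boolean connectives. For $p:\square^P\to X$, $p\models\langle\mathbf i_P^Q\rangle F$ iff there is a track $q:\square^Q\to X$ with $q\models F$ and $p=q\circ\mathbf i_P^Q$. For $p:\square^Q\to X$, $p\models\overline{\langle\mathbf i_P^Q\rangle}F$ iff $p\circ\mathbf i_P^Q\models F$. A formula is *forward* if it contains no backward modality $\overline{\langle\cdot\rangle}$. **Theorem.** Let $S$ be a conclist and let $Y,Z\in\mathrm{HDA}_S$ be finitely branching. 1. $Y$ and $Z$ are track-bisimilar if and only if their initial tracks $\iota_Y,\iota_Z$ satisfy the same forward IPML formulas. 2. $Y$ and $Z$ are strong track-bisimilar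 if and only if $\iota_Y,\iota_Z$ satisfy the same IPML formulas (with forward and backward modalities). -/

import Mathlib

open CategoryTheory Opposite

universe u v

namespace IpomsetModalLogic

/-! ## Concurrency lists and precubical sets -/

/-- The three possible states of an event: `zero` (not yet started), `exec` (active),
`one` (terminated). -/
inductive Status
  | zero
  | exec
  | one

/-- A concurrency list over the alphabet `L`: a finite set of events, totally ordered by the
strict order `ev` (written `⇢`), with a labelling in `L`. -/
structure Conclist (L : Type u) where
  Event : Type v
  finite : Finite Event
  ev : Event → Event → Prop
  label : Event → L
  ev_irrefl : ∀ x, ¬ ev x x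
  ev_trans : ∀ x y z, ev x y → ev y z → ev x z
  ev_total : ∀ x y, x ≠ y → ev x y ∨ ev y x

/-- A conclist map `(f, ε) : U → V`. -/
@[ext]
structure Conclist.Hom {L : Type u} (U V : Conclist.{u, v} L) : Type v where
  toFun : U.Event → V.Event
  status : V.Event → Status
  map_label : ∀ x, V.label (toFun x) = U.label x
  map_ev : ∀ x y, U.ev x y → V.ev (toFun x) (toFun y)
  status_exec : ∀ y, status y = Status.exec ↔ y ∈ Set.range toFun

namespace Conclist

variable {L : Type u}

theorem Hom.injective {U V : Conclist.{u, v} L} (d : Hom U V) :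
    Function.Injective d.toFun := by
  intro x y h
  by_contra hne
  rcases U.ev_total x y hne with h' | h'
  · exact V.ev_irrefl _ (by simpa [h] using d.map_ev _ _ h')
  · exact V.ev_irrefl _ (by simpa [h] using d.map_ev _ _ h')

/-- The identity conclist map. -/
def Hom.id (U : Conclist.{u, v} L) : Hom U U where
  toFun := fun x => x
  status := fun _ => Status.exec
  map_label := fun _ => rfl
  map_ev := fun _ _ h => h
  status_exec := fun y => ⟨fun _ => ⟨y, rfl⟩, fun _ => rfl⟩

/-- Composition `(g, ζ) ∘ (f, ε) = (g ∘ f, η)`, where `η u = ε (g⁻¹ u)` on the image of `g` and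
`η u = ζ u` elsewhere. -/
noncomputable def Hom.comp {U V W : Conclist.{u, v} L} (d : Hom U V) (e : Hom V W) :
    Hom U W where
  toFun := fun x => e.toFun (d.toFun x)
  status := Function.extend e.toFun d.status e.status
  map_label := fun x => by rw [e.map_label, d.map_label]
  map_ev := fun _ _ h => e.map_ev _ _ (d.map_ev _ _ h)
  status_exec := by
    intro w
    by_cases hw : ∃ y, e.toFun y = w
    · obtain ⟨y, rfl⟩ := hw
      rw [e.injective.extend_apply, d.status_exec]
      constructor
      · rintro ⟨x, rfl⟩
        exact ⟨x, rfl⟩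
      · rintro ⟨x, hx⟩
        exact ⟨x, e.injective hx⟩
    · rw [Function.extend_apply' _ _ _ hw, e.status_exec]
      constructor
      · intro h
        exact absurd h hw
      · rintro ⟨x, hx⟩
        exact absurd ⟨_, hx⟩ hw

end Conclist

/-- Associativity of the composition of status functions. -/
theorem extend_assoc {B C D E : Type*} {g : B → C} {h : C → D}
    (hg : Function.Injective g) (hh : Function.Injective h)
    (a : B → E) (b : C → E) (c : D → E) :
    Function.extend (h ∘ g) a (Function.extend h b c) =
      Function.extend h (Function.extend g a b) c := by
  funext d
  by_cases hd : ∃ x, h x = d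
  · obtain ⟨x, rfl⟩ := hd
    rw [hh.extend_apply]
    by_cases hx : ∃ y, g y = x
    · obtain ⟨y, rfl⟩ := hx
      rw [hg.extend_apply]
      exact (hh.comp hg).extend_apply a _ y
    · rw [Function.extend_apply' _ _ _ hx, Function.extend_apply', hh.extend_apply]
      rintro ⟨y, hy⟩
      exact hx ⟨y, hh hy⟩
  · rw [Function.extend_apply' _ _ _ hd, Function.extend_apply', Function.extend_apply' _ _ _ hd]
    rintro ⟨y, hy⟩
    exact hd ⟨_, hy⟩

/-- Left unit law for status functions. -/
theorem extend_exec {B C : Type*} (g : B → C) (c : C → Status)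
    (hc : ∀ y, c y = Status.exec ↔ y ∈ Set.range g) (hg : Function.Injective g) :
    Function.extend g (fun _ => Status.exec) c = c := by
  funext d
  by_cases hd : ∃ x, g x = d
  · obtain ⟨x, rfl⟩ := hd
    rw [hg.extend_apply, (hc _).2 ⟨x, rfl⟩]
  · rw [Function.extend_apply' _ _ _ hd]

/-- Right unit law for status functions. -/
theorem extend_id {B C : Type*} (a b : B → C) : Function.extend (fun x => x) a b = a := by
  funext d
  exact Function.injective_id.extend_apply a b d

/-- The labelled precube category `□` of conclists and conclist maps. -/
noncomputable instance Conclist.category (L : Type u) : Category (Conclist.{u, v} L) where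
  Hom := Conclist.Hom
  id := Conclist.Hom.id
  comp := Conclist.Hom.comp
  id_comp := by
    intro U V d
    exact Conclist.Hom.ext rfl (extend_exec _ _ d.status_exec d.injective)
  comp_id := by
    intro U V d
    exact Conclist.Hom.ext rfl (extend_id _ _)
  assoc := by
    intro U V W Z d e f
    exact Conclist.Hom.ext rfl (extend_assoc e.injective f.injective _ _ _).symm

/-- A precubical set is a presheaf on `□`; precubical maps are natural transformations. -/
abbrev PrecubicalSet (L : Type u) := (Conclist.{u, v} L)ᵒᵖ ⥤ Type v

/-- The cells of a precubical set, with their lists of events. -/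
abbrev PrecubicalSet.Cell {L : Type u} (X : PrecubicalSet.{u, v} L) :=
  Σ U : Conclist.{u, v} L, X.obj (op U)

/-- `x` is a face of `y`: it is the image of `y` under some face map. -/
def PrecubicalSet.IsFace {L : Type u} (X : PrecubicalSet.{u, v} L) (x y : X.Cell) : Prop :=
  ∃ d : x.1 ⟶ y.1, X.map d.op y.2 = x.2

/-- Two cells that correspond to each other under renaming the events along the (unique)
isomorphism of their conclists; such cells count as one cell. -/
def PrecubicalSet.SameCell {L : Type u} (X : PrecubicalSet.{u, v} L) (x y : X.Cell) : Prop :=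
  ∃ e : x.1 ≅ y.1, X.map e.hom.op y.2 = x.2

/-- A precubical set is finitely branching if every cell is the face of a finite number of
cells (up to renaming of events). -/
def PrecubicalSet.FinitelyBranching {L : Type u} (X : PrecubicalSet.{u, v} L) : Prop :=
  ∀ x : X.Cell, ∃ t : Finset X.Cell, ∀ y : X.Cell, X.IsFace x y → ∃ z ∈ t, X.SameCell y z

/-- A higher-dimensional automaton over `L` whose initial cell has conclist of events `S`. -/
structure HDA {L : Type u} (S : Conclist.{u, v} L) where
  X : PrecubicalSet.{u, v} L
  init : X.obj (op S)
  final : Set X.Cell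

/-! ## Interval ipomsets -/

/-- An interval pomset with interfaces: `prec` is the precedence order `<`, `ev` the event
order `⇢`. -/
structure Ipomset (L : Type u) where
  Event : Type v
  finite : Finite Event
  prec : Event → Event → Prop
  ev : Event → Event → Prop
  label : Event → L
  source : Set Event
  target : Set Event
  prec_irrefl : ∀ x, ¬ prec x x
  prec_trans : ∀ x y z, prec x y → prec y z → prec x z
  ev_irrefl : ∀ x, ¬ ev x x
  ev_trans : ∀ x y z, ev x y → ev y z → ev x z
  total : ∀ x y, x ≠ y → prec x y ∨ prec y x ∨ ev x y ∨ ev y x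
  source_minimal : ∀ x ∈ source, ∀ y, ¬ prec y x
  target_maximal : ∀ x ∈ target, ∀ y, ¬ prec x y
  interval : ∀ x y z w, prec x z → prec y w → prec x w ∨ prec y z

/-- The relation `⪯` between the states of two events `q < q'`. -/
def Status.Compat : Status → Status → Prop
  | .one, _ => True
  | _, .zero => True
  | .exec, .exec => True
  | _, _ => False

/-- Two distinct events that are not comparable by the precedence order. -/
def Ipomset.Parallel {L : Type u} (P : Ipomset.{u, v} L) (x y : P.Event) : Prop :=
  x ≠ y ∧ ¬ P.prec x y ∧ ¬ P.prec y x

/-- A morphism `(f, ε) : P → Q` of the category `IP` of interval ipomsets. -/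
@[ext]
structure Ipomset.Hom {L : Type u} (P Q : Ipomset.{u, v} L) : Type v where
  toFun : P.Event → Q.Event
  status : Q.Event → Status
  injective : Function.Injective toFun
  map_label : ∀ x, Q.label (toFun x) = P.label x
  reflect_prec : ∀ x y, Q.prec (toFun x) (toFun y) → P.prec x y
  map_ev : ∀ x y, P.Parallel x y → P.ev x y → Q.ev (toFun x) (toFun y)
  status_exec : ∀ y, status y = Status.exec ↔ y ∈ Set.range toFun
  status_compat : ∀ q q', Q.prec q q' → Status.Compat (status q) (status q')

namespace Ipomset

variable {L : Type u}

/-- The identity morphism. -/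
def Hom.id (P : Ipomset.{u, v} L) : Hom P P where
  toFun := fun x => x
  status := fun _ => Status.exec
  injective := fun _ _ h => h
  map_label := fun _ => rfl
  reflect_prec := fun _ _ h => h
  map_ev := fun _ _ _ h => h
  status_exec := fun y => ⟨fun _ => ⟨y, rfl⟩, fun _ => rfl⟩
  status_compat := fun _ _ _ => trivial

/-- Composition of morphisms, by the same formula as for conclist maps. -/
noncomputable def Hom.comp {P Q R : Ipomset.{u, v} L} (d : Hom P Q) (e : Hom Q R) :
    Hom P R where
  toFun := fun x => e.toFun (d.toFun x)
  status := Function.extend e.toFun d.status e.status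
  injective := e.injective.comp d.injective
  map_label := fun x => by rw [e.map_label, d.map_label]
  reflect_prec := fun _ _ h => d.reflect_prec _ _ (e.reflect_prec _ _ h)
  map_ev := by
    intro x y hp h
    refine e.map_ev _ _ ⟨fun h' => hp.1 (d.injective h'), fun h' => ?_, fun h' => ?_⟩
      (d.map_ev _ _ hp h)
    · exact hp.2.1 (d.reflect_prec _ _ h')
    · exact hp.2.2 (d.reflect_prec _ _ h')
  status_exec := by
    intro w
    by_cases hw : ∃ y, e.toFun y = w
    · obtain ⟨y, rfl⟩ := hw
      rw [e.injective.extend_apply, d.status_exec]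
      constructor
      · rintro ⟨x, rfl⟩
        exact ⟨x, rfl⟩
      · rintro ⟨x, hx⟩
        exact ⟨x, e.injective hx⟩
    · rw [Function.extend_apply' _ _ _ hw, e.status_exec]
      constructor
      · intro h
        exact absurd h hw
      · rintro ⟨x, hx⟩
        exact absurd ⟨_, hx⟩ hw
  status_compat := by
    intro r r' hr
    have hc := e.status_compat r r' hr
    by_cases h : ∃ y, e.toFun y = r
    · obtain ⟨y, rfl⟩ := h
      by_cases h' : ∃ y, e.toFun y = r'
      · obtain ⟨y', rfl⟩ := h'
        rw [e.injective.extend_apply, e.injective.extend_apply]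
        exact d.status_compat _ _ (e.reflect_prec _ _ hr)
      · rw [Function.extend_apply' _ _ _ h', e.injective.extend_apply]
        have h1 : e.status (e.toFun y) = Status.exec := (e.status_exec _).2 ⟨y, rfl⟩
        have h2 : e.status r' ≠ Status.exec := fun h'' => h' ((e.status_exec _).1 h'')
        rw [h1] at hc
        generalize e.status r' = s at hc h2 ⊢
        generalize d.status y = s'
        cases s <;> cases s' <;> simp_all [Status.Compat]
    · rw [Function.extend_apply' _ _ _ h]
      by_cases h' : ∃ y, e.toFun y = r'
      · obtain ⟨y', rfl⟩ := h'
        rw [e.injective.extend_apply]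
        have h1 : e.status (e.toFun y') = Status.exec := (e.status_exec _).2 ⟨y', rfl⟩
        have h2 : e.status r ≠ Status.exec := fun h'' => h ((e.status_exec _).1 h'')
        rw [h1] at hc
        generalize e.status r = s at hc h2 ⊢
        generalize d.status y' = s'
        cases s <;> cases s' <;> simp_all [Status.Compat]
      · rw [Function.extend_apply' _ _ _ h']
        exact hc

/-- The category `IP` of interval ipomsets. -/
noncomputable instance category (L : Type u) : Category (Ipomset.{u, v} L) where
  Hom := Hom
  id := Hom.id
  comp := Hom.comp
  id_comp := by
    intro P Q d
    exact Hom.ext rfl (extend_exec _ _ d.status_exec d.injective)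
  comp_id := by
    intro P Q d
    exact Hom.ext rfl (extend_id _ _)
  assoc := by
    intro P Q R T d e f
    exact Hom.ext rfl (extend_assoc e.injective f.injective _ _ _).symm

/-- The source interface of an ipomset, as a conclist. -/
def sourceConclist (P : Ipomset.{u, v} L) : Conclist.{u, v} L where
  Event := {x : P.Event // x ∈ P.source}
  finite := by
    have := P.finite
    infer_instance
  ev := fun x y => P.ev x.1 y.1
  label := fun x => P.label x.1
  ev_irrefl := fun x => P.ev_irrefl x.1
  ev_trans := fun x y z => P.ev_trans x.1 y.1 z.1
  ev_total := by
    intro x y h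
    rcases P.total x.1 y.1 (fun h' => h (Subtype.ext h')) with h' | h' | h' | h'
    · exact absurd h' (P.source_minimal _ y.2 _)
    · exact absurd h' (P.source_minimal _ x.2 _)
    · exact Or.inl h'
    · exact Or.inr h'

end Ipomset

/-- A conclist `U` as the discrete ipomset with all events in both interfaces. -/
def Conclist.toIpomset {L : Type u} (U : Conclist.{u, v} L) : Ipomset.{u, v} L where
  Event := U.Event
  finite := U.finite
  prec := fun _ _ => False
  ev := U.ev
  label := U.label
  source := Set.univ
  target := Set.univ
  prec_irrefl := fun _ h => h
  prec_trans := fun _ _ _ h _ => h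
  ev_irrefl := U.ev_irrefl
  ev_trans := U.ev_trans
  total := fun x y h => Or.inr (Or.inr (U.ev_total x y h))
  source_minimal := fun _ _ _ h => h
  target_maximal := fun _ _ _ h => h
  interval := fun _ _ _ _ h _ => h.elim

/-- Conclist maps are exactly the morphisms of `IP` between the corresponding ipomsets. -/
def Conclist.homEquiv {L : Type u} (U V : Conclist.{u, v} L) :
    (U ⟶ V) ≃ (U.toIpomset ⟶ V.toIpomset) where
  toFun := fun d =>
    { toFun := Conclist.Hom.toFun d
      status := Conclist.Hom.status d
      injective := Conclist.Hom.injective d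
      map_label := Conclist.Hom.map_label d
      reflect_prec := fun _ _ h => h
      map_ev := fun x y _ h => Conclist.Hom.map_ev d x y h
      status_exec := Conclist.Hom.status_exec d
      status_compat := fun _ _ h => h.elim }
  invFun := fun d =>
    { toFun := Ipomset.Hom.toFun d
      status := Ipomset.Hom.status d
      map_label := Ipomset.Hom.map_label d
      map_ev := fun x y h => Ipomset.Hom.map_ev d x y
        ⟨fun h' => U.ev_irrefl x (h' ▸ h), fun h' => h', fun h' => h'⟩ h
      status_exec := Ipomset.Hom.status_exec d }
  left_inv := fun _ => rfl
  right_inv := fun _ => rfl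

/-- The inclusion of `□` into `IP`. -/
noncomputable def conclistToIP (L : Type u) : Conclist.{u, v} L ⥤ Ipomset.{u, v} L where
  obj := Conclist.toIpomset
  map := fun {U V} d => Conclist.homEquiv U V d
  map_id := fun _ => rfl
  map_comp := fun _ _ => rfl

/-! ## Track objects and tracks -/

/-- The functor `Tr` sending an ipomset `P` to the track object `□^P`, whose cells are
`□^P[U] = hom_IP(U, P)`, and acting on morphisms by composition. -/
noncomputable def Tr (L : Type u) : Ipomset.{u, v} L ⥤ PrecubicalSet.{u, v} L :=
  yoneda ⋙ (Functor.whiskeringLeft _ _ (Type v)).obj (conclistToIP.{u, v} L).op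

/-- A track in `X` with domain `□^P`. -/
abbrev Track {L : Type u} (P : Ipomset.{u, v} L) (X : PrecubicalSet.{u, v} L) :=
  (Tr.{u, v} L).obj P ⟶ X

/-- The initial track `ι : □^S → X`, the precubical map that sends the top cell of `□^S` to the
initial cell. -/
noncomputable def HDA.initialTrack {L : Type u} {S : Conclist.{u, v} L} (Y : HDA S) :
    Track S.toIpomset Y.X where
  app := fun U => TypeCat.ofHom fun c : ((Tr.{u, v} L).obj S.toIpomset).obj U =>
    Y.X.map ((Conclist.homEquiv U.unop S).symm c).op Y.init
  naturality := by
    intro U V d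
    apply ConcreteCategory.hom_ext
    intro c
    change Y.X.map (d.unop ≫ (Conclist.homEquiv U.unop S).symm c).op Y.init =
      Y.X.map d (Y.X.map ((Conclist.homEquiv U.unop S).symm c).op Y.init)
    rw [op_comp, Functor.map_comp]
    rfl

/-- The defining property of the initial track. -/
theorem HDA.initialTrack_top {L : Type u} {S : Conclist.{u, v} L} (Y : HDA S) :
    Y.initialTrack.app (op S) (𝟙 S.toIpomset) = Y.init := by
  have h : (Conclist.homEquiv S S).symm (𝟙 S.toIpomset) = 𝟙 S := rfl
  change Y.X.map ((Conclist.homEquiv S S).symm (𝟙 S.toIpomset)).op Y.init = Y.init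
  rw [h, op_id, Y.X.map_id]
  rfl

/-! ## Initial inclusions -/

/-- `Q`, with the maps `j : P → Q` and `k : R → Q`, is the gluing composition `P * R` (up to
isomorphism): the disjoint union of `P` and `R` with `T_P` identified with `S_R`. Since `Q.ev`
is irreflexive, the identification `T_P ≃ S_R` is an isomorphism of conclists. -/
structure IsGluing {L : Type u} (P R Q : Ipomset.{u, v} L)
    (j : P.Event → Q.Event) (k : R.Event → Q.Event) : Prop where
  injective_left : Function.Injective j
  injective_right : Function.Injective k
  cover : Set.range j ∪ Set.range k = Set.univ
  overlap : Set.range j ∩ Set.range k = j '' P.target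
  interfaces : j '' P.target = k '' R.source
  label_left : ∀ p, Q.label (j p) = P.label p
  label_right : ∀ r, Q.label (k r) = R.label r
  prec_iff : ∀ q q', Q.prec q q' ↔
    (∃ p p', j p = q ∧ j p' = q' ∧ P.prec p p') ∨
    (∃ r r', k r = q ∧ k r' = q' ∧ R.prec r r') ∨
    (∃ p r, j p = q ∧ k r = q' ∧ p ∉ P.target ∧ r ∉ R.source)
  ev_iff : ∀ q q', Q.ev q q' ↔ Relation.TransGen
    (fun a b => (∃ p p', j p = a ∧ j p' = b ∧ P.ev p p') ∨
      (∃ r r', k r = a ∧ k r' = b ∧ R.ev r r')) q q'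
  source_eq : Q.source = j '' P.source
  target_eq : Q.target = k '' R.target

/-- A morphism `P → Q` of `IP` is an initial inclusion `i_P^{P*R}` if `Q` is a gluing `P * R`
with `P` included through the morphism, and all events outside `P` have status `0`. -/
def Ipomset.IsInitialInclusion {L : Type u} {P Q : Ipomset.{u, v} L} (i : P ⟶ Q) : Prop :=
  (∃ (R : Ipomset.{u, v} L) (k : R.Event → Q.Event), IsGluing P R Q (Ipomset.Hom.toFun i) k) ∧
    ∀ q, q ∉ Set.range (Ipomset.Hom.toFun i) → Ipomset.Hom.status i q = Status.zero

/-- The objects of `T⁰_S`: interval ipomsets `P` with `S_P ≃ S`. -/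
structure PathObj {L : Type u} (S : Conclist.{u, v} L) where
  ipomset : Ipomset.{u, v} L
  source_iso : Nonempty (ipomset.sourceConclist ≅ S)

/-- The morphisms of `T⁰_S`: initial inclusions. -/
structure InitialInclusion {L : Type u} {S : Conclist.{u, v} L} (P Q : PathObj S) where
  hom : P.ipomset ⟶ Q.ipomset
  isInitial : Ipomset.IsInitialInclusion hom

/-- The conclist `S` itself as an object of `T⁰_S`. -/
def PathObj.base {L : Type u} (S : Conclist.{u, v} L) : PathObj S where
  ipomset := S.toIpomset
  source_iso := ⟨{
    hom :=
      { toFun := fun x => x.1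
        status := fun _ => Status.exec
        map_label := fun _ => rfl
        map_ev := fun _ _ h => h
        status_exec := fun y => ⟨fun _ => ⟨⟨y, trivial⟩, rfl⟩, fun _ => rfl⟩ }
    inv :=
      { toFun := fun x => ⟨x, trivial⟩
        status := fun _ => Status.exec
        map_label := fun _ => rfl
        map_ev := fun _ _ h => h
        status_exec := fun y => ⟨fun _ => ⟨y.1, rfl⟩, fun _ => rfl⟩ }
    hom_inv_id := Conclist.Hom.ext rfl (extend_exec _ _
      (fun y => ⟨fun _ => ⟨y.1, rfl⟩, fun _ => rfl⟩) fun _ _ h => congrArg Subtype.val h)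
    inv_hom_id := Conclist.Hom.ext rfl (extend_exec _ _
      (fun y => ⟨fun _ => ⟨⟨y, trivial⟩, rfl⟩, fun _ => rfl⟩) fun _ _ h => Subtype.ext h) }⟩

/-- Restriction `q ∘ i_P^Q : □^P → X` of a track `q : □^Q → X` along an initial inclusion. -/
noncomputable def InitialInclusion.restrict {L : Type u} {S : Conclist.{u, v} L} {P Q : PathObj S}
    (i : InitialInclusion P Q) {X : PrecubicalSet.{u, v} L} (q : Track Q.ipomset X) :
    Track P.ipomset X :=
  (Tr.{u, v} L).map i.hom ≫ q

/-! ## Track-bisimulations -/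

/-- A track-bisimulation between `Y` and `Z`: a relation between tracks with a common domain
that relates the initial tracks and has the extension property in both directions. -/
structure IsTrackBisimulation {L : Type u} {S : Conclist.{u, v} L} (Y Z : HDA S)
    (R : ∀ P : PathObj S, Track P.ipomset Y.X → Track P.ipomset Z.X → Prop) : Prop where
  initial : R (PathObj.base S) Y.initialTrack Z.initialTrack
  forth : ∀ (P Q : PathObj S) (i : InitialInclusion P Q)
    (p₁ : Track P.ipomset Y.X) (p₂ : Track P.ipomset Z.X), R P p₁ p₂ →
    ∀ p₁' : Track Q.ipomset Y.X, i.restrict p₁' = p₁ →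
      ∃ p₂' : Track Q.ipomset Z.X, R Q p₁' p₂' ∧ i.restrict p₂' = p₂
  back : ∀ (P Q : PathObj S) (i : InitialInclusion P Q)
    (p₁ : Track P.ipomset Y.X) (p₂ : Track P.ipomset Z.X), R P p₁ p₂ →
    ∀ p₂' : Track Q.ipomset Z.X, i.restrict p₂' = p₂ →
      ∃ p₁' : Track Q.ipomset Y.X, R Q p₁' p₂' ∧ i.restrict p₁' = p₁

/-- A strong track-bisimulation is moreover closed under restriction along initial inclusions. -/
structure IsStrongTrackBisimulation {L : Type u} {S : Conclist.{u, v} L} (Y Z : HDA S)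
    (R : ∀ P : PathObj S, Track P.ipomset Y.X → Track P.ipomset Z.X → Prop) : Prop extends
    IsTrackBisimulation Y Z R where
  restrict : ∀ (P Q : PathObj S) (i : InitialInclusion P Q)
    (p₁ : Track Q.ipomset Y.X) (p₂ : Track Q.ipomset Z.X), R Q p₁ p₂ →
      R P (i.restrict p₁) (i.restrict p₂)

/-- `Y` and `Z` are track-bisimilar. -/
def TrackBisimilar {L : Type u} {S : Conclist.{u, v} L} (Y Z : HDA S) : Prop :=
  ∃ R, IsTrackBisimulation Y Z R

/-- `Y` and `Z` are strong track-bisimilar. -/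
def StrongTrackBisimilar {L : Type u} {S : Conclist.{u, v} L} (Y Z : HDA S) : Prop :=
  ∃ R, IsStrongTrackBisimulation Y Z R

/-! ## Ipomset modal logic -/

/-- Formulas of IPML that can be evaluated at tracks with domain `□^P`. All connectives are
finitary; `dia i` is the forward modality and `bdia i` the backward modality of `i`. -/
inductive Formula {L : Type u} {S : Conclist.{u, v} L} : PathObj S → Type (max u (v + 1))
  | top {P : PathObj S} : Formula P
  | bot {P : PathObj S} : Formula P
  | neg {P : PathObj S} (F : Formula P) : Formula P
  | and {P : PathObj S} (F G : Formula P) : Formula P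
  | or {P : PathObj S} (F G : Formula P) : Formula P
  | dia {P Q : PathObj S} (i : InitialInclusion P Q) (F : Formula Q) : Formula P
  | bdia {Q P : PathObj S} (i : InitialInclusion Q P) (F : Formula Q) : Formula P

/-- The forward formulas: those without backward modalities. -/
def Formula.IsForward {L : Type u} {S : Conclist.{u, v} L} :
    {P : PathObj S} → Formula P → Prop
  | _, .top => True
  | _, .bot => True
  | _, .neg F => F.IsForward
  | _, .and F G => F.IsForward ∧ G.IsForward
  | _, .or F G => F.IsForward ∧ G.IsForward
  | _, .dia _ F => F.IsForward
  | _, .bdia _ _ => False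

/-- Satisfaction `p ⊨ F` of a formula by a track `p : □^P → X`. -/
def Sat {L : Type u} {S : Conclist.{u, v} L} {X : PrecubicalSet.{u, v} L} :
    {P : PathObj S} → Track P.ipomset X → Formula P → Prop
  | _, _, .top => True
  | _, _, .bot => False
  | _, p, .neg F => ¬ Sat p F
  | _, p, .and F G => Sat p F ∧ Sat p G
  | _, p, .or F G => Sat p F ∨ Sat p G
  | _, p, .dia (Q := Q) i F => ∃ q : Track Q.ipomset X, Sat q F ∧ p = i.restrict q
  | _, p, .bdia (Q := Q) i F => ∃ q : Track Q.ipomset X, Sat q F ∧ q = i.restrict p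

end IpomsetModalLogic

/-!
The theorem is of Hennessy–Milner type. One direction is an induction on formulas. For the other,
the relation "satisfies the same formulas" is a bisimulation as soon as every track has only
finitely many extensions along a given initial inclusion (`finite_extensions`): if each of these
extensions in `Z` differed from a given extension in `Y` by some formula, the conjunction of these
formulas under a forward modality would separate the original tracks. This uses only truth,
negation, conjunction and the forward modalities (`IsFragment`), so it covers both parts; with
backward modalities the relation is moreover closed under restriction.

That finiteness is where finite branching enters. Say that a set of tracks takes finitely many
values at a cell of `□^Q` if its members send that cell to finitely many elements. This property
passes from a cell to its faces by functoriality, and from a face to the whole cell by finite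
branching (`finite_values_face`, `finite_values_coface`). All tracks extending a given one agree
on the cell without events all of whose statuses are `zero`, and every cell of `□^Q` is joined to
it by a zigzag of faces: a `<`-maximal terminated event can be turned back into an active and then
into an unstarted one. So the extensions take finitely many values at every cell, and a track is
determined by its values at one cell for each status function on `Q`, of which there are finitely
many.
-/

namespace IpomsetModalLogic

variable {L : Type u}

/-! ### Cells of finitely branching precubical sets -/

instance : Finite Status :=
  Finite.of_surjective
    (fun n : Fin 3 => if n = 0 then Status.zero else if n = 1 then Status.exec else Status.one) <| by
    rintro (_ | _ | _)
    · exact ⟨0, rfl⟩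
    · exact ⟨1, rfl⟩
    · exact ⟨2, rfl⟩

instance (U V : Conclist.{u, v} L) : Finite (U ⟶ V) := by
  have := U.finite
  have := V.finite
  refine Finite.of_injective
    (fun d : U ⟶ V => (Conclist.Hom.toFun d, Conclist.Hom.status d)) fun d e h => ?_
  exact Conclist.Hom.ext (congrArg Prod.fst h) (congrArg Prod.snd h)

/-- Finite branching bounds cells up to renaming; for a fixed conclist `V` it bounds the elements
of `X[V]` themselves, since there are only finitely many renamings onto `V`. -/
theorem PrecubicalSet.FinitelyBranching.finite_cofaces {X : PrecubicalSet.{u, v} L}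
    (hX : X.FinitelyBranching) (x : X.Cell) (V : Conclist.{u, v} L) :
    {y : X.obj (op V) | X.IsFace x ⟨V, y⟩}.Finite := by
  obtain ⟨t, ht⟩ := hX x
  refine (Set.Finite.biUnion t.finite_toSet fun z _ =>
    Set.finite_range fun d : V ⟶ z.1 => X.map d.op z.2).subset fun y hy => ?_
  obtain ⟨z, hz, e, he⟩ := ht ⟨V, y⟩ hy
  exact Set.mem_biUnion hz ⟨e.hom, he⟩

/-! ### Cells of track objects -/

namespace Ipomset

/-- The conclist of the events that are active in a status function `ε`, provided that they are
pairwise incomparable in the precedence order. -/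
def activeConclist (Q : Ipomset.{u, v} L) (ε : Q.Event → Status)
    (hε : ∀ x y, ε x = Status.exec → ε y = Status.exec → ¬ Q.prec x y) : Conclist.{u, v} L where
  Event := {x : Q.Event // ε x = Status.exec}
  finite := by
    have := Q.finite
    infer_instance
  ev := fun x y => Q.ev x.1 y.1
  label := fun x => Q.label x.1
  ev_irrefl := fun x => Q.ev_irrefl x.1
  ev_trans := fun x y z => Q.ev_trans x.1 y.1 z.1
  ev_total := by
    intro x y h
    rcases Q.total x.1 y.1 (fun h' => h (Subtype.ext h')) with h' | h' | h' | h'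
    · exact absurd h' (hε _ _ x.2 y.2)
    · exact absurd h' (hε _ _ y.2 x.2)
    · exact Or.inl h'
    · exact Or.inr h'

/-- The cell of `□^Q` with a given status function. -/
def cellOfStatus (Q : Ipomset.{u, v} L) (ε : Q.Event → Status)
    (hε : ∀ x y, ε x = Status.exec → ε y = Status.exec → ¬ Q.prec x y)
    (hc : ∀ x y, Q.prec x y → Status.Compat (ε x) (ε y)) :
    (Q.activeConclist ε hε).toIpomset ⟶ Q :=
  show Hom _ _ from
  { toFun := fun x => x.1
    status := ε
    injective := fun _ _ h => Subtype.ext h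
    map_label := fun _ => rfl
    reflect_prec := fun x y h => hε _ _ x.2 y.2 h
    map_ev := fun _ _ _ h => h
    status_exec := fun y => ⟨fun h => ⟨⟨y, h⟩, rfl⟩, fun ⟨x, hx⟩ => hx ▸ x.2⟩
    status_compat := hc }

/-- The faces of a cell `c'` of `□^Q` are read off from the status functions: `c` is a face of `c'`
if they agree on the events that are not active in `c'`. In particular, cells with the same status
function are faces of each other. -/
theorem exists_face_of_status {Q : Ipomset.{u, v} L} {U V : Conclist.{u, v} L}
    (c : U.toIpomset ⟶ Q) (c' : V.toIpomset ⟶ Q)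
    (h : ∀ y, Hom.status c' y ≠ Status.exec → Hom.status c y = Hom.status c' y) :
    ∃ d : U ⟶ V, (conclistToIP.{u, v} L).map d ≫ c' = c := by
  have hr : ∀ x, ∃ z, Hom.toFun c' z = Hom.toFun c x := by
    intro x
    have hx : Hom.status c (Hom.toFun c x) = Status.exec := (Hom.status_exec c _).2 ⟨x, rfl⟩
    refine (Hom.status_exec c' _).1 ?_
    by_contra hne
    exact hne ((h _ hne).symm.trans hx)
  choose f hf using hr
  have hpar : ∀ (W : Conclist.{u, v} L) (x y : W.Event), W.ev x y → W.toIpomset.Parallel x y :=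
    fun W x y hxy => ⟨fun h' => W.ev_irrefl x (h' ▸ hxy), fun h' => h', fun h' => h'⟩
  let d : Conclist.Hom U V :=
    { toFun := f
      status := fun v => Hom.status c (Hom.toFun c' v)
      map_label := fun x =>
        (Hom.map_label c' (f x)).symm.trans ((congrArg Q.label (hf x)).trans (Hom.map_label c x))
      map_ev := by
        intro x y hxy
        have hQ := Hom.map_ev c x y (hpar U x y hxy) hxy
        rw [← hf x, ← hf y] at hQ
        by_cases hne : f x = f y
        · rw [hne] at hQ
          exact absurd hQ (Q.ev_irrefl _)
        rcases V.ev_total _ _ hne with h' | h'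
        · exact h'
        · exact absurd (Q.ev_trans _ _ _ hQ (Hom.map_ev c' _ _ (hpar V _ _ h') h'))
            (Q.ev_irrefl _)
      status_exec := by
        intro v
        rw [Hom.status_exec c]
        constructor
        · rintro ⟨x, hx⟩
          exact ⟨x, Hom.injective c' ((hf x).trans hx)⟩
        · rintro ⟨x, rfl⟩
          exact ⟨x, (hf x).symm⟩ }
  refine ⟨d, Hom.ext (funext hf) ?_⟩
  change Function.extend (Hom.toFun c') (fun v => Hom.status c (Hom.toFun c' v))
    (Hom.status c') = Hom.status c
  funext y
  by_cases hy : ∃ z, Hom.toFun c' z = y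
  · obtain ⟨z, rfl⟩ := hy
    exact (Hom.injective c').extend_apply _ _ z
  · rw [Function.extend_apply' _ _ _ hy]
    exact (h y fun h' => hy ((Hom.status_exec c' y).1 h')).symm

end Ipomset

/-! ### Finiteness of the extensions of a track -/

theorem Track.app_face {Q : Ipomset.{u, v} L} {X : PrecubicalSet.{u, v} L} (q : Track Q X)
    {U V : Conclist.{u, v} L} (d : U ⟶ V) (c : V.toIpomset ⟶ Q) :
    q.app (op U) ((conclistToIP.{u, v} L).map d ≫ c) = X.map d.op (q.app (op V) c) :=
  congrArg (fun f => f c) (q.naturality d.op)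

section FiniteValues

variable {Q : Ipomset.{u, v} L} {X : PrecubicalSet.{u, v} L}

theorem finite_values_face (T : Set (Track Q X)) {U V : Conclist.{u, v} L} (d : U ⟶ V)
    (c : V.toIpomset ⟶ Q) (h : ((fun q : Track Q X => q.app (op V) c) '' T).Finite) :
    ((fun q : Track Q X => q.app (op U) ((conclistToIP.{u, v} L).map d ≫ c)) '' T).Finite := by
  refine (h.image fun x => X.map d.op x).subset ?_
  rintro _ ⟨q, hq, rfl⟩
  exact ⟨_, ⟨q, hq, rfl⟩, (q.app_face d c).symm⟩

theorem finite_values_coface (hX : X.FinitelyBranching) (T : Set (Track Q X))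
    {U V : Conclist.{u, v} L} (d : U ⟶ V) (c : V.toIpomset ⟶ Q)
    (h : ((fun q : Track Q X =>
      q.app (op U) ((conclistToIP.{u, v} L).map d ≫ c)) '' T).Finite) :
    ((fun q : Track Q X => q.app (op V) c) '' T).Finite := by
  refine (h.biUnion fun x _ => hX.finite_cofaces ⟨U, x⟩ V).subset ?_
  rintro _ ⟨q, hq, rfl⟩
  exact Set.mem_biUnion ⟨q, hq, rfl⟩ ⟨d, (q.app_face d c).symm⟩

/-- Connectedness of `□^Q` propagates finiteness from a cell all of whose statuses are `zero` to
every cell. -/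
theorem finite_values_of_zero (hX : X.FinitelyBranching) (T : Set (Track Q X))
    {W : Conclist.{u, v} L} (z : W.toIpomset ⟶ Q)
    (hz : ∀ y, Ipomset.Hom.status z y = Status.zero)
    (h : ((fun q : Track Q X => q.app (op W) z) '' T).Finite)
    {U : Conclist.{u, v} L} (c : U.toIpomset ⟶ Q) :
    ((fun q : Track Q X => q.app (op U) c) '' T).Finite := by
  classical
  have := Q.finite
  induction hn : {y | Ipomset.Hom.status c y = Status.one}.ncard using Nat.strong_induction_on
    generalizing U c with
  | _ n ih =>
  subst hn
  by_cases hone : {y | Ipomset.Hom.status c y = Status.one}.Nonempty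
  · -- A `<`-maximal terminated event `x` is made active, giving a cell `e` with fewer terminated
    -- events; `e` and `c` share the face `w` whose terminated events are those of `c`.
    have : IsTrans Q.Event (fun a b => Q.prec b a) := ⟨fun a b c h h' => Q.prec_trans _ _ _ h' h⟩
    have : Std.Irrefl (fun a b : Q.Event => Q.prec b a) := ⟨Q.prec_irrefl⟩
    obtain ⟨x, hx, hmax⟩ := (Finite.wellFounded_of_trans_of_irrefl
      (fun a b : Q.Event => Q.prec b a)).has_min _ hone
    have hdown : ∀ y y', Q.prec y y' → Ipomset.Hom.status c y' = Status.one →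
        Ipomset.Hom.status c y = Status.one := by
      intro y y' hy h1
      have hc := Ipomset.Hom.status_compat c y y' hy
      rw [h1] at hc
      generalize Ipomset.Hom.status c y = s at hc
      cases s <;> simp_all [Status.Compat]
    let εw : Q.Event → Status :=
      fun y => if Ipomset.Hom.status c y = Status.one then Status.one else Status.zero
    let εe : Q.Event → Status := fun y => if y = x then Status.exec else εw y
    have hwexec : ∀ y, εw y ≠ Status.exec := by
      intro y
      dsimp only [εw]
      split_ifs <;> simp
    have heexec : ∀ y, εe y = Status.exec → y = x := by
      intro y hy
      by_contra hne
      exact hwexec y (by simpa [εe, hne] using hy)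
    let w := Q.cellOfStatus εw (fun y _ hy => absurd hy (hwexec y)) <| by
      intro y y' hy
      by_cases h1 : Ipomset.Hom.status c y' = Status.one
      · simp [εw, hdown y y' hy h1, Status.Compat]
      · by_cases h2 : Ipomset.Hom.status c y = Status.one <;> simp [εw, h1, h2, Status.Compat]
    let e := Q.cellOfStatus εe
      (fun y y' hy hy' => by
        rw [heexec y hy, heexec y' hy']
        exact Q.prec_irrefl x) <| by
      intro y y' hy
      by_cases hy'x : y' = x
      · subst hy'x
        have hne : y ≠ y' := fun h' => Q.prec_irrefl _ (h' ▸ hy)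
        simp [εe, εw, hne, hdown y y' hy hx, Status.Compat]
      · by_cases h1 : Ipomset.Hom.status c y' = Status.one
        · have hne : y ≠ x := fun h' => hmax y' h1 (h' ▸ hy)
          simp [εe, εw, hne, hdown y y' hy h1, Status.Compat]
        · have h0 : εe y' = Status.zero := by simp [εe, εw, hy'x, h1]
          rw [h0]
          cases εe y <;> trivial
    obtain ⟨d, hd⟩ := Ipomset.exists_face_of_status w e <| by
      intro y hy
      have hne : y ≠ x := by
        rintro rfl
        exact hy (if_pos rfl)
      exact (if_neg hne).symm
    obtain ⟨d', hd'⟩ := Ipomset.exists_face_of_status w c <| by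
      intro y hy
      change εw y = _
      generalize hs : Ipomset.Hom.status c y = s at hy
      cases s <;> simp_all [εw]
    refine finite_values_coface hX T d' c ?_
    rw [hd', ← hd]
    refine finite_values_face T d e (ih _ ?_ e rfl)
    refine Set.ncard_lt_ncard ⟨fun y (hy : εe y = Status.one) => ?_, fun hsub => ?_⟩
      (Set.toFinite _)
    · by_contra hne
      have hne' : Ipomset.Hom.status c y ≠ Status.one := hne
      by_cases hyx : y = x
      · exact hne' (hyx ▸ hx)
      · simp [εe, εw, hne', hyx] at hy
    · have hx' : εe x = Status.one := hsub hx
      simp [εe] at hx'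
  · obtain ⟨d, hd⟩ := Ipomset.exists_face_of_status z c <| by
      intro y hy
      rw [hz]
      have hy' : Ipomset.Hom.status c y ≠ Status.one := fun h' => hone ⟨y, h'⟩
      generalize Ipomset.Hom.status c y = s at hy hy'
      cases s <;> simp_all
    refine finite_values_coface hX T d c ?_
    rwa [hd]

/-- A track is determined by its values at one cell for each status function. -/
theorem finite_of_finite_values (T : Set (Track Q X))
    (h : ∀ (U : Conclist.{u, v} L) (c : U.toIpomset ⟶ Q),
      ((fun q : Track Q X => q.app (op U) c) '' T).Finite) : T.Finite := by
  have := Q.finite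
  let I := {ε : Q.Event → Status //
    ∃ (U : Conclist.{u, v} L) (c : U.toIpomset ⟶ Q), Ipomset.Hom.status c = ε}
  have hI : ∀ ε : I, ∃ (U : Conclist.{u, v} L) (c : U.toIpomset ⟶ Q),
    Ipomset.Hom.status c = ε.1 := fun ε => ε.2
  choose V r hr using hI
  let ev : Track Q X → ∀ ε : I, X.obj (op (V ε)) := fun q ε => q.app (op (V ε)) (r ε)
  have hinj : Function.Injective ev := by
    intro q q' hq
    ext U c
    obtain ⟨d, hd⟩ := Ipomset.exists_face_of_status c
      (r ⟨Ipomset.Hom.status c, U.unop, c, rfl⟩) (fun y _ => by rw [hr])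
    have hv : q.app _ (r ⟨Ipomset.Hom.status c, U.unop, c, rfl⟩) = q'.app _ (r _) :=
      congrFun hq _
    have h₁ := Track.app_face q d (r ⟨Ipomset.Hom.status c, U.unop, c, rfl⟩)
    have h₂ := Track.app_face q' d (r ⟨Ipomset.Hom.status c, U.unop, c, rfl⟩)
    rw [hd] at h₁ h₂
    exact h₁.trans ((congrArg _ hv).trans h₂.symm)
  refine Set.Finite.of_finite_image ?_ hinj.injOn
  refine (Set.Finite.pi' fun ε : I => h (V ε) (r ε)).subset ?_
  rintro _ ⟨q, hq, rfl⟩ ε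
  exact ⟨q, hq, rfl⟩

end FiniteValues

/-- In a finitely branching precubical set, a track has only finitely many extensions along an
initial inclusion. -/
theorem finite_extensions {S : Conclist.{u, v} L} {X : PrecubicalSet.{u, v} L}
    (hX : X.FinitelyBranching) {P Q : PathObj S} (i : InitialInclusion P Q)
    (p : Track P.ipomset X) : {q : Track Q.ipomset X | i.restrict q = p}.Finite := by
  let z := P.ipomset.cellOfStatus (fun _ => Status.zero) (fun _ _ h => nomatch h)
    (fun _ _ _ => trivial)
  refine finite_of_finite_values _ fun U c => finite_values_of_zero hX _ (z ≫ i.hom) ?_ ?_ c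
  · intro y
    change Function.extend (Ipomset.Hom.toFun i.hom) (fun _ => Status.zero)
      (Ipomset.Hom.status i.hom) y = Status.zero
    by_cases hy : ∃ x, Ipomset.Hom.toFun i.hom x = y
    · obtain ⟨x, rfl⟩ := hy
      exact (Ipomset.Hom.injective i.hom).extend_apply _ _ x
    · rw [Function.extend_apply' _ _ _ hy]
      exact i.isInitial.2 y hy
  · refine (Set.finite_singleton (p.app _ z)).subset ?_
    rintro _ ⟨q, rfl, rfl⟩
    rfl

/-! ### Bisimulations and the logic -/

section Logic

variable {S : Conclist.{u, v} L} {Y Z : HDA S}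

theorem IsTrackBisimulation.sat_iff
    {R : ∀ P : PathObj S, Track P.ipomset Y.X → Track P.ipomset Z.X → Prop}
    (hR : IsTrackBisimulation Y Z R) {P : PathObj S} (F : Formula P) (hF : F.IsForward)
    {p₁ : Track P.ipomset Y.X} {p₂ : Track P.ipomset Z.X} (h : R P p₁ p₂) :
    Sat p₁ F ↔ Sat p₂ F := by
  induction F with
  | top => exact Iff.rfl
  | bot => exact Iff.rfl
  | neg F ih => exact not_congr (ih hF h)
  | and F G ihF ihG => exact and_congr (ihF hF.1 h) (ihG hF.2 h)
  | or F G ihF ihG => exact or_congr (ihF hF.1 h) (ihG hF.2 h)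
  | dia i F ih =>
    constructor
    · rintro ⟨q₁, hq, rfl⟩
      obtain ⟨q₂, hq₂, rfl⟩ := hR.forth _ _ i _ _ h q₁ rfl
      exact ⟨q₂, (ih hF hq₂).1 hq, rfl⟩
    · rintro ⟨q₂, hq, rfl⟩
      obtain ⟨q₁, hq₁, rfl⟩ := hR.back _ _ i _ _ h q₂ rfl
      exact ⟨q₁, (ih hF hq₁).2 hq, rfl⟩
  | bdia i F _ => exact hF.elim

theorem IsStrongTrackBisimulation.sat_iff
    {R : ∀ P : PathObj S, Track P.ipomset Y.X → Track P.ipomset Z.X → Prop}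
    (hR : IsStrongTrackBisimulation Y Z R) {P : PathObj S} (F : Formula P)
    {p₁ : Track P.ipomset Y.X} {p₂ : Track P.ipomset Z.X} (h : R P p₁ p₂) :
    Sat p₁ F ↔ Sat p₂ F := by
  induction F with
  | top => exact Iff.rfl
  | bot => exact Iff.rfl
  | neg F ih => exact not_congr (ih h)
  | and F G ihF ihG => exact and_congr (ihF h) (ihG h)
  | or F G ihF ihG => exact or_congr (ihF h) (ihG h)
  | dia i F ih =>
    constructor
    · rintro ⟨q₁, hq, rfl⟩
      obtain ⟨q₂, hq₂, rfl⟩ := hR.forth _ _ i _ _ h q₁ rfl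
      exact ⟨q₂, (ih hq₂).1 hq, rfl⟩
    · rintro ⟨q₂, hq, rfl⟩
      obtain ⟨q₁, hq₁, rfl⟩ := hR.back _ _ i _ _ h q₂ rfl
      exact ⟨q₁, (ih hq₁).2 hq, rfl⟩
  | bdia i F ih =>
    have hi := ih (hR.restrict _ _ i _ _ h)
    constructor
    · rintro ⟨_, hq, rfl⟩
      exact ⟨_, hi.1 hq, rfl⟩
    · rintro ⟨_, hq, rfl⟩
      exact ⟨_, hi.2 hq, rfl⟩

/-- A family of formulas closed under the operations that separate tracks: truth, negation,
conjunction and the forward modalities. -/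
structure IsFragment (Φ : ∀ P : PathObj S, Formula P → Prop) : Prop where
  top : ∀ P, Φ P .top
  neg : ∀ P F, Φ P F → Φ P (.neg F)
  and : ∀ P F G, Φ P F → Φ P G → Φ P (.and F G)
  dia : ∀ P Q (i : InitialInclusion P Q) F, Φ Q F → Φ P (.dia i F)

/-- Two tracks satisfy the same formulas of `Φ`. -/
def Agree (Φ : ∀ P : PathObj S, Formula P → Prop) {X X' : PrecubicalSet.{u, v} L} (P : PathObj S)
    (p₁ : Track P.ipomset X) (p₂ : Track P.ipomset X') : Prop :=
  ∀ F, Φ P F → (Sat p₁ F ↔ Sat p₂ F)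

/-- A track that agrees with no member of a finite set of tracks is separated from all of them by
a single formula. -/
theorem IsFragment.exists_separating {Φ : ∀ P : PathObj S, Formula P → Prop} (hΦ : IsFragment Φ)
    {X X' : PrecubicalSet.{u, v} L} {P : PathObj S} (p : Track P.ipomset X)
    {T : Set (Track P.ipomset X')} (hT : T.Finite) (h : ∀ q ∈ T, ¬ Agree Φ P p q) :
    ∃ F, Φ P F ∧ Sat p F ∧ ∀ q ∈ T, ¬ Sat q F := by
  induction T, hT using Set.Finite.induction_on with
  | empty => exact ⟨.top, hΦ.top P, trivial, fun _ hq => hq.elim⟩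
  | @insert q T _ _ ih =>
    obtain ⟨F, hF, hpF, hTF⟩ := ih fun q' hq' => h q' (Set.mem_insert_of_mem _ hq')
    obtain ⟨G, hG, hpG, hqG⟩ : ∃ G, Φ P G ∧ Sat p G ∧ ¬ Sat q G := by
      have hq := h q (Set.mem_insert _ _)
      simp only [Agree, not_forall] at hq
      obtain ⟨G, hG, hne⟩ := hq
      by_cases hp : Sat p G
      · exact ⟨G, hG, hp, fun hq => hne ⟨fun _ => hq, fun _ => hp⟩⟩
      · exact ⟨.neg G, hΦ.neg P G hG, hp, fun hq => hne ⟨fun h' => absurd h' hp,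
          fun h' => absurd h' hq⟩⟩
    refine ⟨.and G F, hΦ.and P G F hG hF, ⟨hpG, hpF⟩, ?_⟩
    rintro q' (rfl | hq') ⟨h₁, h₂⟩
    · exact hqG h₁
    · exact hTF q' hq' h₂

theorem IsFragment.exists_agree_extension {Φ : ∀ P : PathObj S, Formula P → Prop}
    (hΦ : IsFragment Φ) {X X' : PrecubicalSet.{u, v} L} (hX' : X'.FinitelyBranching)
    {P Q : PathObj S} (i : InitialInclusion P Q) (q₁ : Track Q.ipomset X)
    (p₂ : Track P.ipomset X') (h : Agree Φ P (i.restrict q₁) p₂) :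
    ∃ q₂ : Track Q.ipomset X', Agree Φ Q q₁ q₂ ∧ i.restrict q₂ = p₂ := by
  by_contra hno
  push Not at hno
  obtain ⟨F, hF, hq₁, hsep⟩ := hΦ.exists_separating q₁ (finite_extensions hX' i p₂)
    fun q hq hagree => hno q hagree hq
  obtain ⟨q₂, hq₂, rfl⟩ := (h (.dia i F) (hΦ.dia P Q i F hF)).1 ⟨q₁, hq₁, rfl⟩
  exact hsep q₂ rfl hq₂

theorem IsFragment.isTrackBisimulation_agree {Φ : ∀ P : PathObj S, Formula P → Prop}
    (hΦ : IsFragment Φ) (hY : Y.X.FinitelyBranching) (hZ : Z.X.FinitelyBranching)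
    (h : Agree Φ (PathObj.base S) Y.initialTrack Z.initialTrack) :
    IsTrackBisimulation Y Z (fun P => Agree Φ P) where
  initial := h
  forth := by
    rintro P Q i _ p₂ hp q₁ rfl
    exact hΦ.exists_agree_extension hZ i q₁ p₂ hp
  back := by
    rintro P Q i p₁ _ hp q₂ rfl
    obtain ⟨q₁, hq, hr⟩ := hΦ.exists_agree_extension hY i q₂ p₁ fun F hF => (hp F hF).symm
    exact ⟨q₁, fun F hF => (hq F hF).symm, hr⟩

end Logic

end IpomsetModalLogic

theorem mainTheorem1 {L : Type u} {S : IpomsetModalLogic.Conclist.{u, v} L}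
    (Y Z : IpomsetModalLogic.HDA S)
    (hY : Y.X.FinitelyBranching) (hZ : Z.X.FinitelyBranching) :
    (IpomsetModalLogic.TrackBisimilar Y Z ↔
      ∀ F : IpomsetModalLogic.Formula (IpomsetModalLogic.PathObj.base S), F.IsForward →
        (IpomsetModalLogic.Sat Y.initialTrack F ↔ IpomsetModalLogic.Sat Z.initialTrack F)) ∧
    (IpomsetModalLogic.StrongTrackBisimilar Y Z ↔
      ∀ F : IpomsetModalLogic.Formula (IpomsetModalLogic.PathObj.base S),
        (IpomsetModalLogic.Sat Y.initialTrack F ↔ IpomsetModalLogic.Sat Z.initialTrack F)) := by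
  refine ⟨⟨?_, fun h => ?_⟩, ⟨?_, fun h => ?_⟩⟩
  · rintro ⟨R, hR⟩ F hF
    exact hR.sat_iff F hF hR.initial
  · have hΦ : IpomsetModalLogic.IsFragment
        (fun (P : IpomsetModalLogic.PathObj S) (F : IpomsetModalLogic.Formula P) => F.IsForward) :=
      ⟨fun _ => trivial, fun _ _ h => h, fun _ _ _ h h' => ⟨h, h'⟩, fun _ _ _ _ h => h⟩
    exact ⟨_, hΦ.isTrackBisimulation_agree hY hZ h⟩
  · rintro ⟨R, hR⟩ F
    exact hR.sat_iff F hR.initial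
  · have hΦ : IpomsetModalLogic.IsFragment
        (fun (P : IpomsetModalLogic.PathObj S) (_ : IpomsetModalLogic.Formula P) => True) :=
      ⟨fun _ => trivial, fun _ _ h => h, fun _ _ _ _ _ => trivial, fun _ _ _ _ h => h⟩
    refine ⟨_, hΦ.isTrackBisimulation_agree hY hZ fun F _ => h F, ?_⟩
    -- A formula `F` at the restrictions is the backward modality of `F` at the tracks themselves.
    intro P Q i p₁ p₂ hp F _
    have hb := hp (.bdia i F) trivial
    constructor
    · intro hs
      obtain ⟨_, hq, rfl⟩ := hb.1 ⟨_, hs, rfl⟩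
      exact hq
    · intro hs
      obtain ⟨_, hq, rfl⟩ := hb.2 ⟨_, hs, rfl⟩
      exact hq
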